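/- For a unit vector $\psi\in\mathbb C^2\otimes\mathbb C^2\otimes\mathbb C^2$ (a pure three-qubit state) let $$G(\psi)=\max_{a,b,c}\,|\langle a\otimes b\otimes c\,|\,\psi\rangle|,\qquad E_G(\psi)=1-G(\psi)^2,$$ where the maximum is over unit vectors $a,b,c\in\mathbb C^2$. For an arbitrary (pure or mixed) three-qubit state, that is, a positive semidefinite operator $\rho$ of trace one on $\mathbb C^2\otimes\mathbb C^2\otimes\mathbb C^2$, let $$E_G(\rho)=\min_{\rho=\sum_i p_i|\psi_i\rangle\langle\psi_i|}\ \sum_i p_i\,E_G(\psi_i),$$ where the minimum is over all decompositions of $\rho$ into finitely many pure states $\psi_i$ with probabilities $p_i\ge 0$, $\sum_i p_i=1$. Let $|\mathrm W\rangle=\frac1{\sqrt3}\left(|100\rangle+|010\rangle+|001\rangle\right)$. Then the W state is maximally entangled among all three-qubit states, mixed ones included, with respect to the geometric measure: $|\mathrm W\rangle\langle\mathrm W|$ is a three-qubit state, and $$E_G(\rho)\le E_G(|\mathrm W\rangle\langle\mathrm W|)$$ for every three-qubit state $\rho$. -/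

import Mathlib

open scoped Matrix ComplexOrder

noncomputable section

namespace ThreeQubit

/-- The one-qubit Hilbert space `ℂ²`. -/
abbrev Qubit : Type := EuclideanSpace ℂ (Fin 2)

/-- Labels `(i, j, k)` of the computational basis `|ijk⟩` of three qubits. -/
abbrev Idx : Type := Fin 2 × Fin 2 × Fin 2

/-- The three-qubit Hilbert space `ℂ² ⊗ ℂ² ⊗ ℂ²`, in the computational basis. -/
abbrev Ket : Type := EuclideanSpace ℂ Idx

/-- The product vector `|a⟩|b⟩|c⟩`. -/
def prodKet (a b c : Qubit) : Ket :=
  WithLp.toLp 2 fun i => a i.1 * b i.2.1 * c i.2.2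

/-- The overlaps `|⟨φ|ψ⟩|` of `ψ` with the normalized product vectors `φ = |a⟩|b⟩|c⟩`. -/
def overlaps (ψ : Ket) : Set ℝ :=
  {r | ∃ a b c : Qubit, ‖a‖ = 1 ∧ ‖b‖ = 1 ∧ ‖c‖ = 1 ∧ r = ‖inner ℂ (prodKet a b c) ψ‖}

/-- `G(ψ)`, the maximal overlap of `ψ` with a normalized product vector. -/
def maxOverlap (ψ : Ket) : ℝ := sSup (overlaps ψ)

/-- The geometric measure of entanglement `E_G(ψ) = 1 - G(ψ)²` of a pure state. -/
def pureGM (ψ : Ket) : ℝ := 1 - maxOverlap ψ ^ 2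

/-- The projector `|ψ⟩⟨ψ|`. -/
def proj (ψ : Ket) : Matrix Idx Idx ℂ := Matrix.vecMulVec ψ.ofLp (star ψ.ofLp)

/-- A three-qubit state, pure or mixed: a positive semidefinite matrix of trace one. -/
def IsState (ρ : Matrix Idx Idx ℂ) : Prop := ρ.PosSemidef ∧ ρ.trace = 1

/-- The averages `∑ pᵢ E_G(ψᵢ)` over all decompositions `ρ = ∑ pᵢ |ψᵢ⟩⟨ψᵢ|` of `ρ` into finitely
many pure states (unit vectors), with probabilities `pᵢ`. -/
def roofValues (ρ : Matrix Idx Idx ℂ) : Set ℝ :=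
  {e | ∃ (n : ℕ) (p : Fin n → ℝ) (ψ : Fin n → Ket),
    (∀ i, 0 ≤ p i) ∧ ∑ i, p i = 1 ∧ (∀ i, ‖ψ i‖ = 1) ∧
    ρ = ∑ i, (p i : ℂ) • proj (ψ i) ∧ e = ∑ i, p i * pureGM (ψ i)}

/-- The geometric measure of entanglement `E_G(ρ)` of a mixed state, by the convex roof. -/
def mixedGM (ρ : Matrix Idx Idx ℂ) : ℝ := sInf (roofValues ρ)

/-- The W state `(|100⟩ + |010⟩ + |001⟩) / √3`. -/
def W : Ket :=
  ((1 / Real.sqrt 3 : ℝ) : ℂ) •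
    (EuclideanSpace.single (1, 0, 0) 1 + EuclideanSpace.single (0, 1, 0) 1 +
      EuclideanSpace.single (0, 0, 1) 1)

/-! The supremum and the infimum above are attained, so they are a maximum and a minimum. -/

lemma continuous_prodKet : Continuous fun x : Qubit × Qubit × Qubit =>
    prodKet x.1 x.2.1 x.2.2 := by
  unfold prodKet
  fun_prop

lemma overlaps_eq (ψ : Ket) : overlaps ψ =
    (fun x : Qubit × Qubit × Qubit => ‖inner ℂ (prodKet x.1 x.2.1 x.2.2) ψ‖) ''
      (Metric.sphere 0 1 ×ˢ Metric.sphere 0 1 ×ˢ Metric.sphere 0 1) := by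
  ext r
  simp only [overlaps, Set.mem_ofPred_eq, Set.mem_image, Set.mem_prod, mem_sphere_zero_iff_norm,
    Prod.exists]
  constructor
  · rintro ⟨a, b, c, ha, hb, hc, rfl⟩
    exact ⟨a, b, c, ⟨ha, hb, hc⟩, rfl⟩
  · rintro ⟨a, b, c, ⟨ha, hb, hc⟩, rfl⟩
    exact ⟨a, b, c, ha, hb, hc, rfl⟩

lemma isCompact_spheres : IsCompact (Metric.sphere (0 : Qubit) 1 ×ˢ
    (Metric.sphere (0 : Qubit) 1 ×ˢ Metric.sphere (0 : Qubit) 1)) :=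
  (isCompact_sphere _ _).prod ((isCompact_sphere _ _).prod (isCompact_sphere _ _))

/-- `G(ψ)` is the maximum of the overlaps. -/
theorem isGreatest_maxOverlap (ψ : Ket) : IsGreatest (overlaps ψ) (maxOverlap ψ) := by
  have hc : IsCompact (overlaps ψ) := by
    rw [overlaps_eq]
    refine isCompact_spheres.image ?_
    have := continuous_prodKet
    fun_prop
  refine hc.isGreatest_sSup ⟨_, EuclideanSpace.single 0 1, EuclideanSpace.single 0 1,
    EuclideanSpace.single 0 1, ?_, ?_, ?_, rfl⟩ <;> simp

lemma continuous_pureGM : Continuous pureGM := by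
  have h : Continuous maxOverlap := by
    have : maxOverlap = fun ψ => sSup ((fun x : Qubit × Qubit × Qubit =>
        ‖inner ℂ (prodKet x.1 x.2.1 x.2.2) ψ‖) ''
          (Metric.sphere 0 1 ×ˢ Metric.sphere 0 1 ×ˢ Metric.sphere 0 1)) := by
      funext ψ
      rw [maxOverlap, overlaps_eq]
    rw [this]
    refine isCompact_spheres.continuous_sSup ?_
    have h2 := continuous_prodKet.comp (continuous_snd (X := Ket))
    exact (Continuous.inner (𝕜 := ℂ) h2 continuous_fst).norm
  unfold pureGM
  fun_prop

lemma continuous_proj : Continuous proj := by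
  unfold proj Matrix.vecMulVec
  refine continuous_matrix fun i j => ?_
  simp only [Matrix.of_apply, Pi.star_apply]
  fun_prop

/-- The set of pairs `(|ψ⟩⟨ψ|, E_G(ψ))`. -/
def pureGraph : Set (Matrix Idx Idx ℂ × ℝ) :=
  (fun ψ : Ket => (proj ψ, pureGM ψ)) '' Metric.sphere 0 1

lemma isCompact_pureGraph : IsCompact pureGraph :=
  (isCompact_sphere _ _).image (continuous_proj.prodMk continuous_pureGM)

lemma mem_roofValues_iff (ρ : Matrix Idx Idx ℂ) (e : ℝ) :
    e ∈ roofValues ρ ↔ (ρ, e) ∈ convexHull ℝ pureGraph := by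
  rw [mem_convexHull_iff_exists_fintype]
  constructor
  · rintro ⟨n, p, ψ, hp, hs, hψ, rfl, rfl⟩
    refine ⟨Fin n, inferInstance, p, fun i => (proj (ψ i), pureGM (ψ i)), hp, hs,
      fun i => ⟨ψ i, by simpa using hψ i, rfl⟩, ?_⟩
    ext1
    · simp [Prod.fst_sum]
    · simp [Prod.snd_sum]
  · rintro ⟨ι, _, w, z, hw, hs, hz, h⟩
    choose ψ hψ hψz using hz
    let f := (Fintype.equivFin ι).symm
    refine ⟨Fintype.card ι, w ∘ f, ψ ∘ f, fun i => hw _, ?_, fun i => by simpa using hψ _, ?_, ?_⟩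
    · rw [← hs]
      exact f.sum_comp w
    · have h2 : ∑ i, (w i • z i).1 = ρ := by
        rw [← Prod.fst_sum, h]
      rw [← h2, ← f.sum_comp]
      simp [← hψz]
    · have h2 : ∑ i, (w i • z i).2 = e := by
        rw [← Prod.snd_sum, h]
      rw [← h2, ← f.sum_comp]
      simp [← hψz]

/-- In finite dimension the convex hull of a compact set is compact. -/
lemma isCompact_convexHull {E : Type*} [AddCommGroup E] [Module ℝ E] [TopologicalSpace E]
    [IsTopologicalAddGroup E] [ContinuousSMul ℝ E] [FiniteDimensional ℝ E]
    {s : Set E} (hs : IsCompact s) : IsCompact (convexHull ℝ s) := by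
  rcases s.eq_empty_or_nonempty with rfl | ⟨x₀, hx₀⟩
  · simp
  let d := Module.finrank ℝ E + 1
  have key : convexHull ℝ s = (fun q : (Fin d → ℝ) × (Fin d → E) => ∑ i, q.1 i • q.2 i) ''
      (stdSimplex ℝ (Fin d) ×ˢ Set.univ.pi fun _ => s) := by
    ext x
    constructor
    · intro hx
      obtain ⟨ι, _, z, w, hz, hi, hw, hs1, rfl⟩ := eq_pos_convex_span_of_mem_convexHull hx
      have hcard : Fintype.card ι ≤ Fintype.card (Fin d) := by
        rw [Fintype.card_fin]
        exact hi.card_le_finrank_succ.trans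
          (Nat.succ_le_succ (Submodule.finrank_le _))
      obtain ⟨f⟩ := Function.Embedding.nonempty_of_card_le hcard
      refine ⟨(Function.extend f w 0, Function.extend f z fun _ => x₀), ⟨⟨?_, ?_⟩, ?_⟩, ?_⟩
      · intro j
        by_cases hj : ∃ i, f i = j
        · obtain ⟨i, rfl⟩ := hj
          simpa [f.injective.extend_apply] using (hw i).le
        · simp [Function.extend_apply' _ _ _ hj]
      · rw [← hs1]
        refine (Fintype.sum_of_injective f f.injective _ _ (fun j hj => ?_) fun i => ?_).symm
        · simp [Function.extend_apply' _ _ _ hj]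
        · simp [f.injective.extend_apply]
      · intro j _
        by_cases hj : ∃ i, f i = j
        · obtain ⟨i, rfl⟩ := hj
          simpa [f.injective.extend_apply] using hz ⟨i, rfl⟩
        · simpa [Function.extend_apply' _ _ _ hj] using hx₀
      · refine (Fintype.sum_of_injective f f.injective _ _ (fun j hj => ?_) fun i => ?_).symm
        · simp [Function.extend_apply' _ _ _ hj]
        · simp [f.injective.extend_apply]
    · rintro ⟨⟨w, z⟩, ⟨hw, hz⟩, rfl⟩
      exact (convex_convexHull ℝ s).sum_mem (fun i _ => hw.1 i) hw.2
        fun i _ => subset_convexHull ℝ s (hz i trivial)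
  rw [key]
  refine ((isCompact_stdSimplex ℝ _).prod (isCompact_univ_pi fun _ => hs)).image ?_
  fun_prop

lemma isCompact_roofValues (ρ : Matrix Idx Idx ℂ) : IsCompact (roofValues ρ) := by
  have h : roofValues ρ = Prod.snd '' (convexHull ℝ pureGraph ∩ Prod.fst ⁻¹' {ρ}) := by
    ext e
    rw [mem_roofValues_iff]
    constructor
    · exact fun h => ⟨(ρ, e), ⟨h, rfl⟩, rfl⟩
    · rintro ⟨⟨σ, e'⟩, ⟨h, rfl⟩, rfl⟩
      exact h
  rw [h]
  exact ((isCompact_convexHull isCompact_pureGraph).inter_right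
    (isClosed_singleton.preimage continuous_fst)).image continuous_snd

lemma roofValues_nonempty {ρ : Matrix Idx Idx ℂ} (hρ : IsState ρ) : (roofValues ρ).Nonempty := by
  have hH := hρ.1.isHermitian
  let f := (Fintype.equivFin Idx).symm
  refine ⟨_, Fintype.card Idx, hH.eigenvalues ∘ f, hH.eigenvectorBasis ∘ f,
    fun i => hρ.1.eigenvalues_nonneg _, ?_, fun i => hH.eigenvectorBasis.orthonormal.1 _, ?_, rfl⟩
  · have h := hH.trace_eq_sum_eigenvalues
    rw [hρ.2] at h
    have h1 : ∑ i, hH.eigenvalues i = 1 := by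
      apply Complex.ofReal_injective
      simpa using h.symm
    rw [← h1]
    exact f.sum_comp hH.eigenvalues
  · refine Eq.trans ?_
      (f.sum_comp fun i => (hH.eigenvalues i : ℂ) • proj (hH.eigenvectorBasis i)).symm
    conv_lhs => rw [hH.spectral_theorem]
    ext i j
    rw [Unitary.conjStarAlgAut_apply]
    simp [Matrix.mul_apply, Matrix.sum_apply, Matrix.diagonal_apply, proj, Matrix.vecMulVec_apply,
      Matrix.star_apply]
    refine Finset.sum_congr rfl fun k _ => ?_
    ring

/-- `E_G(ρ)` is the minimum of the averages over all decompositions of the state `ρ`. -/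
theorem isLeast_mixedGM {ρ : Matrix Idx Idx ℂ} (hρ : IsState ρ) :
    IsLeast (roofValues ρ) (mixedGM ρ) :=
  (isCompact_roofValues ρ).isLeast_sInf (roofValues_nonempty hρ)

end ThreeQubit

end

open scoped Matrix ComplexOrder

namespace ThreeQubit

/-! Everything reduces to two facts: `4 / 9 ≤ G(ψ)²` for every pure state, and `G(W)² ≤ 4 / 9`. The
first bounds every convex roof by `5 / 9`. Since a rank-one projector decomposes only into multiples
of the same vector, the second gives the projector onto W a roof of at least `5 / 9`.

For the lower bound, the slices of `ψ` along the first qubit form a pencil `A, B`. Fixing the first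
factor of the product vector selects a unit combination `M = c A + s B`, and the best overlap is
then the largest singular value of `M`. That value is at least `2 / 3` once the characteristic
polynomial of `M * Mᴴ` is nonpositive at `4 / 9` (`charpoly_pos_of_bilin_le`).

A unitary change of basis makes `|det|` maximal at `A`, which removes the cross term: `det M = c²
det A + s² det B`. Phases of `c, s` make the two terms oppose each other, and a sign invisible to
the determinant keeps the Frobenius norm at least its average. What remains is the real inequality
`exists_weight` in the weight `x = |c|²`. -/

/-! ### Singular values of two-by-two matrices -/

/-- The squared Frobenius norm of a two-by-two matrix. -/
noncomputable def frobSq (M : Matrix (Fin 2) (Fin 2) ℂ) : ℝ :=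
  ‖M 0 0‖ ^ 2 + ‖M 0 1‖ ^ 2 + ‖M 1 0‖ ^ 2 + ‖M 1 1‖ ^ 2

/-- The value of the bilinear form with matrix `M`. -/
def bilin (M : Matrix (Fin 2) (Fin 2) ℂ) (b c : Fin 2 → ℂ) : ℂ := b ⬝ᵥ M *ᵥ c

/-- The matrix with rows `(α, β)` and `(-β̄, ᾱ)` is a scalar multiple of a unitary. -/
lemma normSq_combo (α β x y : ℂ) :
    ‖α * x + β * y‖ ^ 2 + ‖-(starRingEnd ℂ β) * x + starRingEnd ℂ α * y‖ ^ 2 =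
      (‖α‖ ^ 2 + ‖β‖ ^ 2) * (‖x‖ ^ 2 + ‖y‖ ^ 2) := by
  simp only [← Complex.normSq_eq_norm_sq, Complex.normSq_apply, Complex.add_re, Complex.add_im,
    Complex.mul_re, Complex.mul_im, Complex.neg_re, Complex.neg_im, Complex.conj_re,
    Complex.conj_im]
  ring

lemma two_mul_norm_det_le_frobSq (M : Matrix (Fin 2) (Fin 2) ℂ) : 2 * ‖M.det‖ ≤ frobSq M := by
  have h : ‖M.det‖ ≤ ‖M 0 0‖ * ‖M 1 1‖ + ‖M 0 1‖ * ‖M 1 0‖ := by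
    rw [Matrix.det_fin_two, ← norm_mul, ← norm_mul]
    exact norm_sub_le _ _
  unfold frobSq
  nlinarith [sq_nonneg (‖M 0 0‖ - ‖M 1 1‖), sq_nonneg (‖M 0 1‖ - ‖M 1 0‖)]

/-- If the largest singular value squared is less than `r`, then the characteristic polynomial of
`M * Mᴴ` is positive at `r`. -/
lemma charpoly_pos_of_bilin_le {M : Matrix (Fin 2) (Fin 2) ℂ} {g r : ℝ} (hgr : g < r)
    (h : ∀ b c : Fin 2 → ℂ,
      ‖bilin M b c‖ ^ 2 ≤ g * (‖b 0‖ ^ 2 + ‖b 1‖ ^ 2) * (‖c 0‖ ^ 2 + ‖c 1‖ ^ 2)) :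
    r * frobSq M < r ^ 2 + ‖M.det‖ ^ 2 := by
  have key : ∀ b0 b1 : ℂ, ‖b0 * M 0 0 + b1 * M 1 0‖ ^ 2 + ‖b0 * M 0 1 + b1 * M 1 1‖ ^ 2 ≤
      g * (‖b0‖ ^ 2 + ‖b1‖ ^ 2) := by
    intro b0 b1
    set u := b0 * M 0 0 + b1 * M 1 0 with hu
    set v := b0 * M 0 1 + b1 * M 1 1 with hv
    -- Equality case of Cauchy–Schwarz: pairing `(u, v)` with its own conjugate gives its squared
    -- norm.
    have h1 := h ![b0, b1] ![starRingEnd ℂ u, starRingEnd ℂ v]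
    have h2 : bilin M ![b0, b1] ![starRingEnd ℂ u, starRingEnd ℂ v] =
        ((‖u‖ ^ 2 + ‖v‖ ^ 2 : ℝ) : ℂ) := by
      push_cast
      rw [← Complex.mul_conj', ← Complex.mul_conj']
      simp [bilin, Matrix.mulVec, dotProduct, Fin.sum_univ_two, hu, hv]
      ring
    rw [h2, Complex.norm_real, Real.norm_eq_abs, sq_abs] at h1
    simp at h1
    rcases (by positivity : 0 ≤ ‖u‖ ^ 2 + ‖v‖ ^ 2).eq_or_lt with h0 | h0
    · rw [← h0]
      have h3 := h ![b0, b1] ![1, 0]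
      simp at h3
      exact (sq_nonneg _).trans h3
    · nlinarith
  have hp := key 1 0
  simp at hp
  set P := ‖M 0 0‖ ^ 2 + ‖M 0 1‖ ^ 2 with hP
  set R := ‖M 1 0‖ ^ 2 + ‖M 1 1‖ ^ 2 with hR
  set Q := M 1 0 * starRingEnd ℂ (M 0 0) + M 1 1 * starRingEnd ℂ (M 0 1) with hQ
  have lagrange : ‖Q‖ ^ 2 + ‖M.det‖ ^ 2 = P * R := by
    rw [hQ, hP, hR, Matrix.det_fin_two]
    simp only [← Complex.normSq_eq_norm_sq, Complex.normSq_apply, Complex.add_re, Complex.add_im,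
      Complex.mul_re, Complex.mul_im, Complex.sub_re, Complex.sub_im, Complex.conj_re,
      Complex.conj_im]
    ring
  have expand : ∀ x : ℝ, ‖Q * M 0 0 + x * M 1 0‖ ^ 2 + ‖Q * M 0 1 + x * M 1 1‖ ^ 2 =
      ‖Q‖ ^ 2 * P + x ^ 2 * R + 2 * x * ‖Q‖ ^ 2 := by
    intro x
    rw [hP, hR, hQ]
    simp only [← Complex.normSq_eq_norm_sq, Complex.normSq_apply, Complex.add_re, Complex.add_im,
      Complex.mul_re, Complex.mul_im, Complex.conj_re, Complex.conj_im, Complex.ofReal_re,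
      Complex.ofReal_im]
    ring
  -- At this test vector the quadratic form of `r - M * Mᴴ` is `r - P` times the characteristic
  -- polynomial `(r - P) * (r - R) - ‖Q‖ ^ 2`.
  have hq := key Q ((r - P : ℝ) : ℂ)
  rw [expand, Complex.norm_real, Real.norm_eq_abs, sq_abs] at hq
  have hrP : 0 < r - P := by linarith
  have hpos : 0 < (r - P) * ((r - P) * (r - R) - ‖Q‖ ^ 2) := by
    nlinarith [mul_pos (sub_pos.2 hgr) (pow_pos hrP 2),
      mul_nonneg (sub_pos.2 hgr).le (sq_nonneg ‖Q‖)]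
  have hpos' := pos_of_mul_pos_right hpos hrP.le
  have hN : frobSq M = P + R := by rw [hP, hR, frobSq]; ring
  rw [hN]
  nlinarith

/-! ### Pencils with a maximal determinant -/

/-- A quadratic polynomial whose modulus grows at most like `|p| (1 + |s|²)` has no linear term. -/
lemma linear_coeff_eq_zero {p m t : ℂ}
    (h : ∀ s : ℂ, ‖p + s * m + s ^ 2 * t‖ ≤ ‖p‖ * (1 + ‖s‖ ^ 2)) : m = 0 := by
  by_contra hm
  have hm' : 0 < ‖m‖ := norm_pos_iff.2 hm
  -- The phase `w` aligns `w * m` with `p`: a small step `ε * w` then gains `ε * ‖m‖`, more than the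
  -- second-order terms can absorb.
  obtain ⟨w, hw, hpw⟩ : ∃ w : ℂ, ‖w‖ = 1 ∧
      ∀ ε : ℝ, 0 < ε → ‖p + ε * w * m‖ = ‖p‖ + ε * ‖m‖ := by
    by_cases hp : p = 0
    · refine ⟨1, by simp, fun ε hε => ?_⟩
      simp [hp, abs_of_pos hε]
    · have hp' : 0 < ‖p‖ := norm_pos_iff.2 hp
      refine ⟨p / ‖p‖ * (‖m‖ / m), ?_, fun ε hε => ?_⟩
      · simp [hp, hm]
      · have : p + ε * (p / ‖p‖ * (‖m‖ / m)) * m = p * ((1 + ε * ‖m‖ / ‖p‖ : ℝ) : ℂ) := by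
          push_cast
          field_simp
        rw [this, norm_mul, Complex.norm_real, Real.norm_of_nonneg (by positivity)]
        field_simp
  let K := ‖p‖ + ‖t‖ + 1
  have hK : 0 < K := by positivity
  let ε := ‖m‖ / K
  have hε : 0 < ε := by positivity
  have h1 := h (ε * w)
  have h2 : ‖p + ε * w * m‖ - ‖((ε : ℂ) * w) ^ 2 * t‖ ≤ ‖p + ε * w * m + (ε * w) ^ 2 * t‖ := by
    have := norm_sub_le (p + ε * w * m + (ε * w) ^ 2 * t) ((ε * w) ^ 2 * t)
    rw [add_sub_cancel_right] at this
    linarith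
  have hn : ‖(ε : ℂ) * w‖ = ε := by simp [hw, abs_of_pos hε]
  rw [hpw ε hε, norm_mul, norm_pow, hn] at h2
  rw [hn] at h1
  have h3 : ε * ‖m‖ < ε * (ε * K) := by
    have : ε * ‖m‖ ≤ ε ^ 2 * (‖p‖ + ‖t‖) := by nlinarith
    have h4 : 0 < ε ^ 2 := by positivity
    simp only [K]
    nlinarith
  have h4 : ε * K = ‖m‖ := by simp only [ε]; field_simp
  rw [h4] at h3
  exact lt_irrefl _ h3

/-- The one-variable inequality behind the lower bound on the maximal overlap. -/
lemma exists_weight {s₁ s₂ z : ℝ} (h2 : 0 ≤ s₂) (h21 : s₂ ≤ s₁) (h1 : 4 * s₁ ≤ 1 + z)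
    (hz : |z| ≤ 1) : ∃ x : ℝ, 0 ≤ x ∧ x ≤ 1 ∧
      (s₁ * x - s₂ * (1 - x)) ^ 2 ≤ 4 / 9 * ((1 + z * (2 * x - 1)) / 2 - 4 / 9) := by
  obtain ⟨hz1, hz2⟩ := abs_le.1 hz
  rcases (h2.trans h21).eq_or_lt with h0 | h0
  · have h20 : s₂ = 0 := le_antisymm (h0 ▸ h21) h2
    refine ⟨1 / 2, by norm_num, by norm_num, ?_⟩
    rw [← h0, h20]
    norm_num
  have hs : 0 < s₁ + s₂ := by positivity
  by_cases hzs : z * (s₁ - s₂) ≤ 1 / 9 * (s₁ + s₂)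
  -- This weight makes the left side vanish.
  · refine ⟨s₂ / (s₁ + s₂), by positivity, (div_le_one hs).2 (by linarith), ?_⟩
    have e1 : s₁ * (s₂ / (s₁ + s₂)) - s₂ * (1 - s₂ / (s₁ + s₂)) = 0 := by field_simp; ring
    have e2 : z * (2 * (s₂ / (s₁ + s₂)) - 1) = -(z * (s₁ - s₂) / (s₁ + s₂)) := by
      field_simp; ring
    have e3 : z * (s₁ - s₂) / (s₁ + s₂) ≤ 1 / 9 := (div_le_iff₀ hs).2 hzs
    rw [e1, e2]
    linarith
  push Not at hzs
  have hz0 : 0 < z := by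
    by_contra hneg
    push Not at hneg
    nlinarith
  by_cases hu : 2 / 9 * z ≤ s₁ * (s₁ + s₂)
  -- The weight used is the vertex of the quadratic (left side minus right side) in `x`; `hu` says
  -- that it does not exceed `1`.
  · set k := z / (s₁ + s₂) with hk
    have hzk : z = k * (s₁ + s₂) := by rw [hk]; field_simp
    have hk0 : 0 < k := by positivity
    refine ⟨(2 / 9 * k + s₂) / (s₁ + s₂), by positivity, ?_, ?_⟩
    · rw [div_le_one hs]
      have : 2 / 9 * k * (s₁ + s₂) ≤ s₁ * (s₁ + s₂) := by rw [hzk] at hu; linarith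
      have := le_of_mul_le_mul_right this hs
      linarith
    · have e1 : s₁ * ((2 / 9 * k + s₂) / (s₁ + s₂)) - s₂ * (1 - (2 / 9 * k + s₂) / (s₁ + s₂)) =
          2 / 9 * k := by field_simp; ring
      have e2 : z * (2 * ((2 / 9 * k + s₂) / (s₁ + s₂)) - 1) = k * (4 / 9 * k - (s₁ - s₂)) := by
        rw [hzk]; field_simp; ring
      rw [e1, e2]
      suffices 9 * k * (s₁ - s₂) ≤ 2 * k ^ 2 + 1 by nlinarith
      have h3 : 9 * z * (s₁ ^ 2 - s₂ ^ 2) ≤ 2 * z ^ 2 + (s₁ + s₂) ^ 2 := by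
        have h4 : (9 * z - 1) * s₁ ^ 2 ≤ 2 * z ^ 2 := by
          rcases le_total (9 * z) 1 with h9 | h9
          · nlinarith [sq_nonneg s₁, sq_nonneg z]
          · have h5 : 16 * s₁ ^ 2 ≤ (1 + z) ^ 2 := by nlinarith
            -- This product is `32 z² - (9 z - 1) (1 + z)²`. Its zero `z = 1 / 3` is the value for
            -- the slices of W.
            have h6 : 0 ≤ (1 - z) * (1 - 3 * z) ^ 2 :=
              mul_nonneg (by linarith) (sq_nonneg _)
            nlinarith [mul_le_mul_of_nonneg_left h5 (by linarith : 0 ≤ 9 * z - 1)]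
        nlinarith [mul_nonneg hz0.le (sq_nonneg s₂), mul_nonneg h0.le h2, sq_nonneg s₂]
      have h7 : 9 * k * (s₁ - s₂) * (s₁ + s₂) ^ 2 ≤ (2 * k ^ 2 + 1) * (s₁ + s₂) ^ 2 := by
        rw [hzk] at h3
        nlinarith
      exact le_of_mul_le_mul_right h7 (by positivity)
  · push Not at hu
    refine ⟨1, by norm_num, le_rfl, ?_⟩
    nlinarith [mul_nonneg h0.le h2]

/-- A square root `ω` is chosen so that `ω ^ 2 * t` points opposite to `p`. -/
lemma exists_phase (p t : ℂ) (htp : ‖t‖ ≤ ‖p‖) : ∃ ω : ℂ, ‖ω‖ = 1 ∧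
    ∀ x y : ℝ, ‖x * p + y * ω ^ 2 * t‖ = |‖p‖ * x - ‖t‖ * y| := by
  by_cases ht : t = 0
  · refine ⟨1, by simp, fun x y => ?_⟩
    simp [ht, abs_mul, mul_comm]
  have hp : p ≠ 0 := by
    rintro rfl
    exact ht (by simpa using htp)
  have hp' : 0 < ‖p‖ := norm_pos_iff.2 hp
  obtain ⟨ω, hω⟩ := IsAlgClosed.exists_pow_nat_eq (-(p / ‖p‖) * (‖t‖ / t)) two_pos
  refine ⟨ω, ?_, fun x y => ?_⟩
  · have h := congrArg norm hω
    rw [norm_pow] at h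
    have h1 : ‖ω‖ ^ 2 = 1 := by simpa [hp, ht] using h
    exact (pow_eq_one_iff_of_nonneg (norm_nonneg _) two_ne_zero).1 h1
  · have h : x * p + y * ω ^ 2 * t = p / ‖p‖ * ((‖p‖ * x - ‖t‖ * y : ℝ) : ℂ) := by
      rw [hω]
      push_cast
      field_simp
      ring
    rw [h, norm_mul, Complex.norm_real, Real.norm_eq_abs]
    simp [hp]

/-- By the parallelogram law the two signs average to the left side, so one of them reaches it. -/
lemma exists_sign_norm_ge (X Y : Fin 2 → Fin 2 → ℂ) : ∃ ε : ℂ, ε ^ 2 = 1 ∧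
    ∑ i, ∑ j, (‖X i j‖ ^ 2 + ‖Y i j‖ ^ 2) ≤ ∑ i, ∑ j, ‖X i j + ε * Y i j‖ ^ 2 := by
  have key : ∀ x y : ℂ, ‖x + 1 * y‖ ^ 2 + ‖x + (-1) * y‖ ^ 2 = 2 * (‖x‖ ^ 2 + ‖y‖ ^ 2) := by
    intro x y
    simp only [← Complex.normSq_eq_norm_sq, Complex.normSq_apply, Complex.add_re, Complex.add_im,
      one_mul, neg_mul, Complex.neg_re, Complex.neg_im]
    ring
  by_contra! h
  have h1 := h 1 (by norm_num)
  have h2 := h (-1) (by norm_num)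
  have h3 : ∑ i, ∑ j, ‖X i j + 1 * Y i j‖ ^ 2 + ∑ i, ∑ j, ‖X i j + (-1) * Y i j‖ ^ 2 =
      2 * ∑ i, ∑ j, (‖X i j‖ ^ 2 + ‖Y i j‖ ^ 2) := by
    simp only [← Finset.sum_add_distrib, Finset.mul_sum, key]
  linarith

lemma frobSq_eq_sum (M : Matrix (Fin 2) (Fin 2) ℂ) : frobSq M = ∑ i, ∑ j, ‖M i j‖ ^ 2 := by
  simp [frobSq, Fin.sum_univ_two]
  ring

lemma frobSq_nonneg (M : Matrix (Fin 2) (Fin 2) ℂ) : 0 ≤ frobSq M := by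
  unfold frobSq
  positivity

lemma det_combo (A B : Matrix (Fin 2) (Fin 2) ℂ) (c s : ℂ) :
    (c • A + s • B).det = c ^ 2 * A.det + c * s * ((A + B).det - A.det - B.det) +
      s ^ 2 * B.det := by
  simp [Matrix.det_fin_two]
  ring

/-- In a pencil of matrices whose determinant is maximal at the first one, some unit combination
has a large singular value. -/
lemma exists_combo_of_max {A B : Matrix (Fin 2) (Fin 2) ℂ} (hAB : frobSq A + frobSq B = 1)
    (h : ∀ c s : ℂ, ‖(c • A + s • B).det‖ ≤ ‖A.det‖ * (‖c‖ ^ 2 + ‖s‖ ^ 2)) :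
    ∃ c s : ℂ, ‖c‖ ^ 2 + ‖s‖ ^ 2 = 1 ∧
      ‖(c • A + s • B).det‖ ^ 2 ≤ 4 / 9 * (frobSq (c • A + s • B) - 4 / 9) := by
  have hm : (A + B).det - A.det - B.det = 0 := by
    refine linear_coeff_eq_zero (p := A.det) (t := B.det) fun s => ?_
    have h1 := h 1 s
    rw [det_combo] at h1
    simpa using h1
  have hdet : ∀ c s : ℂ, (c • A + s • B).det = c ^ 2 * A.det + s ^ 2 * B.det := by
    intro c s
    rw [det_combo, hm]
    ring
  have h21 : ‖B.det‖ ≤ ‖A.det‖ := by simpa using h 0 1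
  have hA := two_mul_norm_det_le_frobSq A
  have hA0 := frobSq_nonneg A
  have hB0 := frobSq_nonneg B
  obtain ⟨x, hx0, hx1, hx⟩ := exists_weight (s₁ := ‖A.det‖) (z := frobSq A - frobSq B)
    (norm_nonneg B.det) h21 (by linarith) (abs_le.2 ⟨by linarith, by linarith⟩)
  obtain ⟨ω, hω, hphase⟩ := exists_phase A.det B.det h21
  obtain ⟨ε, hε, hsum⟩ := exists_sign_norm_ge (fun i j => (√x : ℂ) * A i j)
    (fun i j => ω * √(1 - x) * B i j)
  have hεn : ‖ε‖ = 1 := by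
    have := congrArg norm hε
    rw [norm_pow, norm_one] at this
    exact (pow_eq_one_iff_of_nonneg (norm_nonneg _) two_ne_zero).1 this
  have hs0 : ((√x : ℝ) : ℂ) ^ 2 = x := by exact_mod_cast Real.sq_sqrt hx0
  have hs1 : ((√(1 - x) : ℝ) : ℂ) ^ 2 = ((1 - x : ℝ) : ℂ) := by
    exact_mod_cast Real.sq_sqrt (sub_nonneg.2 hx1)
  have hn0 : ‖((√x : ℝ) : ℂ)‖ ^ 2 = x := by
    rw [← norm_pow, hs0, Complex.norm_real, Real.norm_of_nonneg hx0]
  have hn1 : ‖((√(1 - x) : ℝ) : ℂ)‖ ^ 2 = 1 - x := by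
    rw [← norm_pow, hs1, Complex.norm_real, Real.norm_of_nonneg (sub_nonneg.2 hx1)]
  refine ⟨√x, ε * (ω * √(1 - x)), ?_, ?_⟩
  · rw [norm_mul, norm_mul, hεn, hω, one_mul, one_mul, hn0, hn1]
    ring
  · have e1 : ‖((√x : ℂ) • A + (ε * (ω * √(1 - x))) • B).det‖ =
        |‖A.det‖ * x - ‖B.det‖ * (1 - x)| := by
      rw [hdet, ← hphase x (1 - x)]
      congr 2
      · rw [hs0]
      · rw [mul_pow, mul_pow, hε, hs1]
        ring
    have e2 : x * frobSq A + (1 - x) * frobSq B ≤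
        frobSq ((√x : ℂ) • A + (ε * (ω * √(1 - x))) • B) := by
      have e3 : x * frobSq A + (1 - x) * frobSq B =
          ∑ i, ∑ j, (‖(√x : ℂ) * A i j‖ ^ 2 + ‖ω * √(1 - x) * B i j‖ ^ 2) := by
        simp only [norm_mul, mul_pow, hn0, hn1, hω, one_mul, frobSq_eq_sum,
          Finset.mul_sum, Finset.sum_add_distrib]
      rw [e3, frobSq_eq_sum]
      simpa [mul_assoc] using hsum
    rw [e1, sq_abs]
    refine hx.trans ?_
    have e4 : (1 + (frobSq A - frobSq B) * (2 * x - 1)) / 2 =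
        x * frobSq A + (1 - x) * frobSq B := by
      have : frobSq B = 1 - frobSq A := by linarith
      rw [this]
      ring
    rw [e4]
    linarith

lemma frobSq_combo (A B : Matrix (Fin 2) (Fin 2) ℂ) (α β : ℂ) :
    frobSq (α • A + β • B) + frobSq (-(starRingEnd ℂ β) • A + starRingEnd ℂ α • B) =
      (‖α‖ ^ 2 + ‖β‖ ^ 2) * (frobSq A + frobSq B) := by
  simp only [frobSq, Matrix.add_apply, Matrix.smul_apply, smul_eq_mul]
  linear_combination normSq_combo α β (A 0 0) (B 0 0) + normSq_combo α β (A 0 1) (B 0 1) +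
    normSq_combo α β (A 1 0) (B 1 0) + normSq_combo α β (A 1 1) (B 1 1)

/-- Compactness gives a maximum on the unit sphere; homogeneity of degree two extends the bound to
all `c, s`. -/
lemma exists_max_det (A B : Matrix (Fin 2) (Fin 2) ℂ) : ∃ α β : ℂ, ‖α‖ ^ 2 + ‖β‖ ^ 2 = 1 ∧
    ∀ c s : ℂ, ‖(c • A + s • B).det‖ ≤ ‖(α • A + β • B).det‖ * (‖c‖ ^ 2 + ‖s‖ ^ 2) := by
  obtain ⟨a, ha, hmax⟩ := (isCompact_sphere (0 : Qubit) 1).exists_isMaxOn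
    ⟨EuclideanSpace.single 0 1, by simp⟩
    (f := fun a : Qubit => ‖(a 0 • A + a 1 • B).det‖) (by fun_prop)
  refine ⟨a 0, a 1, ?_, fun c s => ?_⟩
  · have := EuclideanSpace.norm_sq_eq a
    rw [mem_sphere_zero_iff_norm.1 ha, Fin.sum_univ_two] at this
    linarith
  · let v : Qubit := !₂[c, s]
    have hv : ‖v‖ ^ 2 = ‖c‖ ^ 2 + ‖s‖ ^ 2 := by
      rw [EuclideanSpace.norm_sq_eq, Fin.sum_univ_two]
      simp [v]
    rw [← hv]
    by_cases h0 : v = 0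
    · have hc : c = 0 := by simpa [v] using congrArg (fun w : Qubit => w 0) h0
      have hs : s = 0 := by simpa [v] using congrArg (fun w : Qubit => w 1) h0
      simp [hc, hs, h0]
    · have hv0 : 0 < ‖v‖ := norm_pos_iff.2 h0
      have h1 := hmax (a := ((‖v‖⁻¹ : ℝ) : ℂ) • v) (by
        rw [mem_sphere_zero_iff_norm, norm_smul, Complex.norm_real,
          Real.norm_of_nonneg (by positivity), inv_mul_cancel₀ hv0.ne'])
      have h2 : (((‖v‖⁻¹ : ℝ) : ℂ) • v) 0 • A + (((‖v‖⁻¹ : ℝ) : ℂ) • v) 1 • B =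
          ((‖v‖⁻¹ : ℝ) : ℂ) • (c • A + s • B) := by
        simp [v, smul_smul]
      simp only [Set.mem_ofPred_eq] at h1
      rw [h2, Matrix.det_smul, norm_mul, norm_pow, Complex.norm_real,
          Real.norm_of_nonneg (by positivity), Fintype.card_fin, inv_pow] at h1
      rwa [inv_mul_le_iff₀ (by positivity), mul_comm] at h1

/-- In a normalized pencil of two-by-two matrices some unit combination has a singular value at
least `2 / 3`, expressed through the characteristic polynomial of `M * Mᴴ` at `4 / 9`. -/
lemma exists_combo {A B : Matrix (Fin 2) (Fin 2) ℂ} (hAB : frobSq A + frobSq B = 1) :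
    ∃ c s : ℂ, ‖c‖ ^ 2 + ‖s‖ ^ 2 = 1 ∧
      ‖(c • A + s • B).det‖ ^ 2 ≤ 4 / 9 * (frobSq (c • A + s • B) - 4 / 9) := by
  obtain ⟨α, β, hαβ, hmax⟩ := exists_max_det A B
  have hcomb : ∀ c s : ℂ,
      c • (α • A + β • B) + s • (-(starRingEnd ℂ β) • A + starRingEnd ℂ α • B) =
        (α * c + -(starRingEnd ℂ β) * s) • A + (β * c + starRingEnd ℂ α * s) • B := by
    intro c s
    module
  have hnorm : ∀ c s : ℂ, ‖α * c + -(starRingEnd ℂ β) * s‖ ^ 2 +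
      ‖β * c + starRingEnd ℂ α * s‖ ^ 2 = ‖c‖ ^ 2 + ‖s‖ ^ 2 := by
    intro c s
    have := normSq_combo α (-(starRingEnd ℂ β)) c s
    simp only [map_neg, Complex.conj_conj, neg_neg, norm_neg, RCLike.norm_conj, hαβ,
      one_mul] at this
    exact this
  obtain ⟨c, s, hcs, h⟩ := exists_combo_of_max (A := α • A + β • B)
    (B := -(starRingEnd ℂ β) • A + starRingEnd ℂ α • B)
    (by rw [frobSq_combo, hαβ, hAB, one_mul]) (fun c s => by
      rw [hcomb, ← hnorm]
      exact hmax _ _)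
  rw [hcomb] at h
  exact ⟨_, _, (hnorm c s).trans hcs, h⟩

/-! ### From pencils to pure three-qubit states -/

/-- The matrix of coefficients of `ψ` with first label `i`. -/
def slice (ψ : Ket) (i : Fin 2) : Matrix (Fin 2) (Fin 2) ℂ := fun j k => ψ (i, j, k)

lemma frobSq_slice (ψ : Ket) : frobSq (slice ψ 0) + frobSq (slice ψ 1) = ‖ψ‖ ^ 2 := by
  rw [EuclideanSpace.norm_sq_eq, Fintype.sum_prod_type]
  simp [Fintype.sum_prod_type, Fin.sum_univ_two, frobSq, slice]
  ring

/-- Complex conjugation in the computational basis. -/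
def conjQubit (a : Qubit) : Qubit := WithLp.toLp 2 (star a.ofLp)

lemma norm_conjQubit (a : Qubit) : ‖conjQubit a‖ = ‖a‖ := by
  simp [conjQubit, EuclideanSpace.norm_eq]

/-- Conjugating the factors cancels the conjugate-linearity of the inner product in its first
argument. -/
lemma inner_prodKet_conjQubit (a b c : Qubit) (ψ : Ket) :
    inner ℂ (prodKet (conjQubit a) (conjQubit b) (conjQubit c)) ψ =
      bilin (a 0 • slice ψ 0 + a 1 • slice ψ 1) b.ofLp c.ofLp := by
  simp [PiLp.inner_apply, Fintype.sum_prod_type, Fin.sum_univ_two, prodKet, conjQubit, bilin, slice,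
    Matrix.mulVec, dotProduct]
  ring

lemma prodKet_smul (r s t : ℂ) (a b c : Qubit) :
    prodKet (r • a) (s • b) (t • c) = (r * s * t) • prodKet a b c := by
  ext i
  simp [prodKet]
  ring

lemma exists_unit_smul (a : Qubit) : ∃ u : Qubit, ‖u‖ = 1 ∧ a = (‖a‖ : ℂ) • u := by
  by_cases h : a = 0
  · exact ⟨EuclideanSpace.single 0 1, by simp, by simp [h]⟩
  · have h' : (‖a‖ : ℂ) ≠ 0 := by simpa using h
    refine ⟨(‖a‖ : ℂ)⁻¹ • a, ?_, ?_⟩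
    · simp [norm_smul, h]
    · rw [smul_inv_smul₀ h']

lemma norm_inner_prodKet_le (a b c : Qubit) (ψ : Ket) :
    ‖inner ℂ (prodKet a b c) ψ‖ ≤ maxOverlap ψ * (‖a‖ * ‖b‖ * ‖c‖) := by
  obtain ⟨u, hu, hau⟩ := exists_unit_smul a
  obtain ⟨v, hv, hbv⟩ := exists_unit_smul b
  obtain ⟨w, hw, hcw⟩ := exists_unit_smul c
  have h := (isGreatest_maxOverlap ψ).2 ⟨u, v, w, hu, hv, hw, rfl⟩
  have e : prodKet a b c = ((‖a‖ : ℂ) * ‖b‖ * ‖c‖) • prodKet u v w := by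
    rw [← prodKet_smul, ← hau, ← hbv, ← hcw]
  rw [e, inner_smul_left, norm_mul, mul_comm]
  have e2 : ‖(starRingEnd ℂ) ((‖a‖ : ℂ) * ‖b‖ * ‖c‖)‖ = ‖a‖ * ‖b‖ * ‖c‖ := by simp
  rw [e2]
  exact mul_le_mul_of_nonneg_right h (by positivity)

/-- Every pure three-qubit state has squared overlap at least `4 / 9` with some product state. -/
theorem four_ninths_le_maxOverlap_sq {ψ : Ket} (hψ : ‖ψ‖ = 1) : 4 / 9 ≤ maxOverlap ψ ^ 2 := by
  by_contra! hlt
  obtain ⟨c, s, hcs, h⟩ := exists_combo (A := slice ψ 0) (B := slice ψ 1)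
    (by rw [frobSq_slice, hψ, one_pow])
  have hsq : ∀ v : Fin 2 → ℂ, ‖(WithLp.toLp 2 v : Qubit)‖ ^ 2 = ‖v 0‖ ^ 2 + ‖v 1‖ ^ 2 := by
    intro v
    rw [EuclideanSpace.norm_sq_eq, Fin.sum_univ_two]
  have h1 := charpoly_pos_of_bilin_le (M := c • slice ψ 0 + s • slice ψ 1) hlt fun x y => by
    have h2 := norm_inner_prodKet_le (conjQubit (WithLp.toLp 2 ![c, s]))
      (conjQubit (WithLp.toLp 2 x)) (conjQubit (WithLp.toLp 2 y)) ψ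
    rw [inner_prodKet_conjQubit] at h2
    have h3 := pow_le_pow_left₀ (norm_nonneg _) h2 2
    simp only [norm_conjQubit, mul_pow, hsq] at h3
    simpa [hcs, mul_assoc] using h3
  linarith

lemma pureGM_le {ψ : Ket} (hψ : ‖ψ‖ = 1) : pureGM ψ ≤ 5 / 9 := by
  have := four_ninths_le_maxOverlap_sq hψ
  unfold pureGM
  linarith

/-! ### The W state -/

/-- Cauchy–Schwarz eliminates `c`. With `u = a₀ b₀ - a₁ b₁`, the cosine of the sum of two angles,
the rest is at most `1 - u² + (1 + u)² / 4`, whose maximum is `4 / 3`, at `u = 1 / 3`. -/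
lemma W_real_bound {a₀ a₁ b₀ b₁ c₀ c₁ : ℝ} (ha₀ : 0 ≤ a₀) (hb₀ : 0 ≤ b₀)
    (ha : a₀ ^ 2 + a₁ ^ 2 = 1) (hb : b₀ ^ 2 + b₁ ^ 2 = 1) (hc : c₀ ^ 2 + c₁ ^ 2 = 1) :
    (a₁ * b₀ * c₀ + a₀ * b₁ * c₀ + a₀ * b₀ * c₁) ^ 2 ≤ 4 / 3 := by
  have h1 : (a₁ * b₀ * c₀ + a₀ * b₁ * c₀ + a₀ * b₀ * c₁) ^ 2 ≤
      (a₁ * b₀ + a₀ * b₁) ^ 2 + (a₀ * b₀) ^ 2 := by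
    have e : (a₁ * b₀ * c₀ + a₀ * b₁ * c₀ + a₀ * b₀ * c₁) ^ 2 +
        ((a₁ * b₀ + a₀ * b₁) * c₁ - a₀ * b₀ * c₀) ^ 2 =
        (a₁ * b₀ + a₀ * b₁) ^ 2 + (a₀ * b₀) ^ 2 := by
      linear_combination ((a₁ * b₀ + a₀ * b₁) ^ 2 + (a₀ * b₀) ^ 2) * hc
    linarith [sq_nonneg ((a₁ * b₀ + a₀ * b₁) * c₁ - a₀ * b₀ * c₀)]
  have h2 : (a₁ * b₀ + a₀ * b₁) ^ 2 = 1 - (a₀ * b₀ - a₁ * b₁) ^ 2 := by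
    linear_combination (b₀ ^ 2 + b₁ ^ 2) * ha + hb
  have h3 : a₀ * b₀ ≤ (1 + (a₀ * b₀ - a₁ * b₁)) / 2 := by
    nlinarith [sq_nonneg (a₀ - b₀), sq_nonneg (a₁ - b₁)]
  have h4 := pow_le_pow_left₀ (mul_nonneg ha₀ hb₀) h3 2
  nlinarith [sq_nonneg (3 * (a₀ * b₀ - a₁ * b₁) - 1)]

lemma inner_prodKet_W (a b c : Qubit) : inner ℂ (prodKet a b c) W =
    ((1 / √3 : ℝ) : ℂ) * starRingEnd ℂ (a 1 * b 0 * c 0 + a 0 * b 1 * c 0 + a 0 * b 0 * c 1) := by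
  simp only [W, inner_smul_right, inner_add_right, EuclideanSpace.inner_single_right, prodKet,
    one_mul, map_add]

lemma maxOverlap_W_sq_le : maxOverlap W ^ 2 ≤ 4 / 9 := by
  obtain ⟨a, b, c, ha, hb, hc, h⟩ := (isGreatest_maxOverlap W).1
  have hsq : ∀ {v : Qubit}, ‖v‖ = 1 → ‖v 0‖ ^ 2 + ‖v 1‖ ^ 2 = 1 := by
    intro v hv
    have := EuclideanSpace.norm_sq_eq v
    rwa [hv, Fin.sum_univ_two, one_pow, eq_comm] at this
  have h1 : ‖a 1 * b 0 * c 0 + a 0 * b 1 * c 0 + a 0 * b 0 * c 1‖ ≤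
      ‖a 1‖ * ‖b 0‖ * ‖c 0‖ + ‖a 0‖ * ‖b 1‖ * ‖c 0‖ + ‖a 0‖ * ‖b 0‖ * ‖c 1‖ := by
    simpa only [norm_mul] using norm_add₃_le (a := a 1 * b 0 * c 0) (b := a 0 * b 1 * c 0)
      (c := a 0 * b 0 * c 1)
  have h2 := W_real_bound (norm_nonneg (a 0)) (norm_nonneg (b 0)) (hsq ha) (hsq hb) (hsq hc)
  have h3 := (pow_le_pow_left₀ (norm_nonneg _) h1 2).trans h2
  rw [h, inner_prodKet_W, norm_mul, RCLike.norm_conj, mul_pow, Complex.norm_real,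
    Real.norm_eq_abs, sq_abs, div_pow, Real.sq_sqrt (by norm_num)]
  linarith

lemma norm_W : ‖W‖ = 1 := by
  have h : ‖W‖ ^ 2 = 1 := by
    rw [← frobSq_slice]
    simp [frobSq, slice, W]
    norm_num
  exact (pow_eq_one_iff_of_nonneg (norm_nonneg _) two_ne_zero).1 h

lemma maxOverlap_smul {r : ℂ} (hr : ‖r‖ = 1) (ψ : Ket) :
    maxOverlap (r • ψ) = maxOverlap ψ := by
  have : overlaps (r • ψ) = overlaps ψ := by
    simp only [overlaps, inner_smul_right, norm_mul, hr, one_mul]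
  rw [maxOverlap, this, maxOverlap]

/-! ### Convex roofs -/

lemma isState_proj {ψ : Ket} (hψ : ‖ψ‖ = 1) : IsState (proj ψ) := by
  refine ⟨Matrix.posSemidef_vecMulVec_self_star _, ?_⟩
  rw [proj, Matrix.trace_vecMulVec, ← EuclideanSpace.inner_eq_star_dotProduct,
    inner_self_eq_norm_sq_to_K, hψ]
  simp

lemma quadForm_proj (φ ψ : Ket) :
    star φ.ofLp ⬝ᵥ proj ψ *ᵥ φ.ofLp = ((‖(inner ℂ φ ψ : ℂ)‖ ^ 2 : ℝ) : ℂ) := by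
  have h1 : inner ℂ φ ψ = ψ.ofLp ⬝ᵥ star φ.ofLp := EuclideanSpace.inner_eq_star_dotProduct _ _
  have h2 : inner ℂ ψ φ = φ.ofLp ⬝ᵥ star ψ.ofLp := EuclideanSpace.inner_eq_star_dotProduct _ _
  rw [proj, Matrix.vecMulVec_mulVec, dotProduct_comm (star ψ.ofLp), ← h2]
  push_cast
  rw [← Complex.mul_conj', inner_conj_symm, h1]
  simp [dotProduct_comm, mul_comm]

/-- In a decomposition of a pure state into pure states all components are multiples of it. -/
lemma eq_smul_of_decomposition {n : ℕ} {φ : Ket} (hφ : ‖φ‖ = 1) {p : Fin n → ℝ}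
    {ψ : Fin n → Ket} (hp : ∀ i, 0 ≤ p i) (hs : ∑ i, p i = 1) (hψ : ∀ i, ‖ψ i‖ = 1)
    (h : proj φ = ∑ i, (p i : ℂ) • proj (ψ i)) {i : Fin n} (hi : p i ≠ 0) :
    ∃ r : ℂ, ‖r‖ = 1 ∧ ψ i = r • φ := by
  -- Evaluated at `φ`, the decomposition says that the squared overlaps, each at most `1`, average
  -- to `1`; so those of nonzero weight equal `1`.
  have h1 := congrArg (fun M => star φ.ofLp ⬝ᵥ M *ᵥ φ.ofLp) h
  simp only [Matrix.sum_mulVec, Matrix.smul_mulVec, dotProduct_sum, dotProduct_smul,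
    quadForm_proj, inner_self_eq_norm_sq_to_K, hφ, smul_eq_mul] at h1
  have h2 : ∑ i, p i * ‖(inner ℂ φ (ψ i) : ℂ)‖ ^ 2 = ∑ i, p i := by
    rw [hs]
    apply Complex.ofReal_injective
    push_cast
    simpa using h1.symm
  have hle : ∀ j, ‖(inner ℂ φ (ψ j) : ℂ)‖ ≤ 1 := fun j => by
    simpa [hφ, hψ j] using norm_inner_le_norm (𝕜 := ℂ) φ (ψ j)
  have h3 := (Finset.sum_eq_sum_iff_of_le fun j _ =>
    mul_le_of_le_one_right (hp j) (pow_le_one₀ (norm_nonneg _) (hle j))).1 h2 i (Finset.mem_univ _)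
  have h4 : ‖(inner ℂ φ (ψ i) : ℂ)‖ = 1 := by
    have : ‖(inner ℂ φ (ψ i) : ℂ)‖ ^ 2 = 1 := by simpa [hi] using h3
    exact (pow_eq_one_iff_of_nonneg (norm_nonneg _) two_ne_zero).1 this
  have hφ0 : φ ≠ 0 := by
    rintro rfl
    simp at hφ
  have hψ0 : ψ i ≠ 0 := by
    intro h0
    simpa [h0] using hψ i
  obtain ⟨r, -, hr⟩ := (norm_inner_eq_norm_iff hφ0 hψ0).1 (by rw [h4, hφ, hψ i, one_mul])
  refine ⟨r, ?_, hr⟩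
  have := hψ i
  rwa [hr, norm_smul, hφ, mul_one] at this

lemma mixedGM_proj_W : 5 / 9 ≤ mixedGM (proj W) := by
  obtain ⟨n, p, ψ, hp, hs, hψ, h, he⟩ := (isLeast_mixedGM (isState_proj norm_W)).1
  rw [he, ← one_mul (5 / 9 : ℝ), ← hs, Finset.sum_mul]
  refine Finset.sum_le_sum fun i _ => ?_
  by_cases hi : p i = 0
  · simp [hi]
  · refine mul_le_mul_of_nonneg_left ?_ (hp i)
    obtain ⟨r, hr, hri⟩ := eq_smul_of_decomposition norm_W hp hs hψ h hi
    rw [hri, pureGM, maxOverlap_smul hr]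
    linarith [maxOverlap_W_sq_le]

lemma mixedGM_le {ρ : Matrix Idx Idx ℂ} (hρ : IsState ρ) : mixedGM ρ ≤ 5 / 9 := by
  obtain ⟨n, p, ψ, hp, hs, hψ, -, he⟩ := (isLeast_mixedGM hρ).1
  rw [he, ← one_mul (5 / 9 : ℝ), ← hs, Finset.sum_mul]
  exact Finset.sum_le_sum fun i _ => mul_le_mul_of_nonneg_left (pureGM_le (hψ i)) (hp i)

end ThreeQubit

theorem theorem2 :
    ThreeQubit.IsState (ThreeQubit.proj ThreeQubit.W) ∧
    ∀ ρ : Matrix ThreeQubit.Idx ThreeQubit.Idx ℂ, ThreeQubit.IsState ρ →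
      ThreeQubit.mixedGM ρ ≤ ThreeQubit.mixedGM (ThreeQubit.proj ThreeQubit.W) :=
  ⟨ThreeQubit.isState_proj ThreeQubit.norm_W, fun _ hρ =>
    (ThreeQubit.mixedGM_le hρ).trans ThreeQubit.mixedGM_proj_W⟩
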